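/- Let $K$ be a number field, let $\phi(x)=x^n+a_{n-1}x^{n-1}+\dots+a_0\in K[x]$ be monic of degree $n\ge 2$, and let $\nu$ be the (additive) valuation at a non-archimedean place of $K$. Let $\mathbb{C}_\nu$ be the completion of an algebraic closure of $K_\nu$. Let $\mathsf{A}^1$ be the Berkovich affine line over $\mathbb{C}_\nu$, i.e. the set of multiplicative seminorms $\zeta=[\cdot]_\zeta$ on $\mathbb{C}_\nu[x]$ extending the absolute value of $\mathbb{C}_\nu$, with the coarsest topology making $\zeta\mapsto[f]_\zeta$ continuous for all $f\in\mathbb{C}_\nu[x]$, and let $\mathsf{P}^1=\mathsf{A}^1\cup\{\infty\}$ be the Berkovich projective line, the one-point compactification of $\mathsf{A}^1$. The polynomial $\phi$ acts on $\mathsf{P}^1$ by $[f]_{\phi(\zeta)}=[f\circ\phi]_\zeta$ and $\phi(\infty)=\infty$. The Fatou set of $\phi$ is the largest open subset of $\mathsf{P}^1$ on which the family of iterates $\{\phi^m\}_{m\ge1}$ is equicontinuous (for the unique uniform structure of the compact Hausdorff space $\mathsf{P}^1$), and the Julia set $J(\phi)$ is its complement. Let $D=\{\zeta\in\mathsf{A}^1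 : [x]_\zeta<1\}$ be the Berkovich open unit disk. Suppose that $\nu(a_0)\le 0$ and $\nu(a_0)<\nu(a_i)$ for all $1\le i\le n-1$. Then $J(\phi)\cap D=\emptyset$. If moreover $\nu(a_0)<0$, then $D$ is contained in the basin of attraction of $\infty$, i.e. $\phi^m(\zeta)\to\infty$ in $\mathsf{P}^1$ as $m\to\infty$ for every $\zeta\in D$. -/

import Mathlib

open Polynomial IsDedekindDomain Filter Topology
open scoped NumberField OnePoint

noncomputable section

/-! ### The Berkovich projective line over a normed field -/

/-- A point of the Berkovich affine line over `F`: a multiplicative seminorm on `F[T]` which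
extends the absolute value of `F`. -/
@[ext]
structure BerkovichAffineLine (F : Type*) [NormedField F] where
  /-- the seminorm `f ↦ [f]_ζ` -/
  seminorm : MulRingSeminorm F[X]
  map_C : ∀ a : F, seminorm (C a) = ‖a‖

namespace BerkovichAffineLine

variable {F : Type*} [NormedField F]

/-- The coarsest topology for which `ζ ↦ [f]_ζ` is continuous for every polynomial `f`. -/
instance instTopologicalSpace : TopologicalSpace (BerkovichAffineLine F) :=
  TopologicalSpace.induced (fun ζ (f : F[X]) => ζ.seminorm f) inferInstance

/-- The absolute value `|ζ| = [T]_ζ`. -/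
def abs (ζ : BerkovichAffineLine F) : ℝ := ζ.seminorm X

/-- The action of a polynomial `φ` on the Berkovich affine line: `[f]_{φ(ζ)} = [f ∘ φ]_ζ`. -/
def map (φ : F[X]) (ζ : BerkovichAffineLine F) : BerkovichAffineLine F where
  seminorm :=
    { toFun := fun f => ζ.seminorm (f.comp φ)
      map_zero' := by simp
      add_le' := fun f g => by simpa using map_add_le_add ζ.seminorm (f.comp φ) (g.comp φ)
      neg' := fun f => by simp
      map_one' := by simp
      map_mul' := fun f g => by simp }
  map_C := fun a => by
    change ζ.seminorm ((C a).comp φ) = ‖a‖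
    simpa using ζ.map_C a

theorem isEmbedding_seminorm :
    IsEmbedding (fun (ζ : BerkovichAffineLine F) (f : F[X]) => ζ.seminorm f) :=
  ⟨⟨rfl⟩, fun _ _ h => BerkovichAffineLine.ext (DFunLike.coe_injective h)⟩

theorem continuous_seminorm (f : F[X]) :
    Continuous fun ζ : BerkovichAffineLine F => ζ.seminorm f :=
  (continuous_apply f).comp isEmbedding_seminorm.continuous

instance instT2Space : T2Space (BerkovichAffineLine F) := isEmbedding_seminorm.t2Space

theorem seminorm_le (ζ : BerkovichAffineLine F) {R : ℝ} (hR : ζ.abs ≤ R) (f : F[X]) :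
    ζ.seminorm f ≤ ∑ i ∈ f.support, ‖f.coeff i‖ * R ^ i := by
  have h0 : 0 ≤ ζ.abs := apply_nonneg ζ.seminorm X
  have hsum : ζ.seminorm (∑ i ∈ f.support, C (f.coeff i) * X ^ i) ≤
      ∑ i ∈ f.support, ζ.seminorm (C (f.coeff i) * X ^ i) :=
    Finset.le_sum_of_subadditive _ (map_zero _).le (fun a b => map_add_le_add _ a b) _ _
  rw [← f.as_sum_support_C_mul_X_pow] at hsum
  refine hsum.trans (Finset.sum_le_sum fun i _ => ?_)
  rw [map_mul, map_pow, ζ.map_C]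
  exact mul_le_mul_of_nonneg_left (pow_le_pow_left₀ h0 hR i) (norm_nonneg _)

theorem isClosedEmbedding_seminorm :
    IsClosedEmbedding (fun (ζ : BerkovichAffineLine F) (f : F[X]) => ζ.seminorm f) := by
  refine ⟨isEmbedding_seminorm, ?_⟩
  have hrange : Set.range (fun (ζ : BerkovichAffineLine F) (f : F[X]) => ζ.seminorm f) =
      {g | g 0 = 0} ∩ {g | ∀ p q, g (p + q) ≤ g p + g q} ∩ {g | ∀ p, g (-p) = g p} ∩
        {g | g 1 = 1} ∩ {g | ∀ p q, g (p * q) = g p * g q} ∩ {g | ∀ a, g (C a) = ‖a‖} := by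
    ext g
    constructor
    · rintro ⟨ζ, rfl⟩
      exact ⟨⟨⟨⟨⟨map_zero _, fun p q => map_add_le_add _ p q⟩, fun p => map_neg_eq_map _ p⟩,
        map_one _⟩, fun p q => map_mul _ p q⟩, ζ.map_C⟩
    · rintro ⟨⟨⟨⟨⟨h0, hadd⟩, hneg⟩, h1⟩, hmul⟩, hC⟩
      let N : MulRingSeminorm F[X] :=
        { toFun := g
          map_zero' := h0
          add_le' := hadd
          neg' := hneg
          map_one' := h1
          map_mul' := hmul }
      exact ⟨⟨N, hC⟩, rfl⟩
  rw [hrange]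
  have hc (p : F[X]) : Continuous fun g : F[X] → ℝ => g p := continuous_apply p
  refine ((((IsClosed.inter ?_ ?_).inter ?_).inter ?_).inter ?_).inter ?_
  · exact isClosed_eq (hc 0) continuous_const
  · simp only [Set.ofPred_forall]
    exact isClosed_iInter fun p => isClosed_iInter fun q =>
      isClosed_le (hc _) ((hc p).add (hc q))
  · simp only [Set.ofPred_forall]
    exact isClosed_iInter fun p => isClosed_eq (hc _) (hc p)
  · exact isClosed_eq (hc 1) continuous_const
  · simp only [Set.ofPred_forall]
    exact isClosed_iInter fun p => isClosed_iInter fun q =>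
      isClosed_eq (hc _) ((hc p).mul (hc q))
  · simp only [Set.ofPred_forall]
    exact isClosed_iInter fun a => isClosed_eq (hc _) continuous_const

theorem isCompact_abs_le (R : ℝ) : IsCompact {ζ : BerkovichAffineLine F | ζ.abs ≤ R} := by
  have hK : IsCompact (Set.univ.pi fun f : F[X] =>
      Set.Icc (0 : ℝ) (∑ i ∈ f.support, ‖f.coeff i‖ * R ^ i)) :=
    isCompact_univ_pi fun _ => isCompact_Icc
  refine (isClosedEmbedding_seminorm.isCompact_preimage hK).of_isClosed_subset
    (isClosed_le (continuous_seminorm X) continuous_const) fun ζ hζ f _ => ?_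
  exact ⟨apply_nonneg ζ.seminorm f, ζ.seminorm_le hζ f⟩

instance instWeaklyLocallyCompactSpace : WeaklyLocallyCompactSpace (BerkovichAffineLine F) where
  exists_compact_mem_nhds ζ :=
    ⟨{ξ | ξ.abs ≤ ζ.abs + 1}, isCompact_abs_le _,
      mem_of_superset ((isOpen_lt (continuous_seminorm X) continuous_const).mem_nhds
        (lt_add_one ζ.abs)) fun ξ (h : ξ.abs < ζ.abs + 1) =>
          show ξ.abs ≤ ζ.abs + 1 from h.le⟩

end BerkovichAffineLine

/-- The Berkovich projective line over `F`, the one-point compactification of the Berkovich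
affine line. -/
abbrev BerkovichProjectiveLine (F : Type*) [NormedField F] : Type _ :=
  OnePoint (BerkovichAffineLine F)

namespace BerkovichProjectiveLine

variable {F : Type*} [NormedField F]

/-- The action of a (non-constant) polynomial on the Berkovich projective line; it fixes `∞`. -/
def map (φ : F[X]) : BerkovichProjectiveLine F → BerkovichProjectiveLine F :=
  OnePoint.map (BerkovichAffineLine.map φ)

variable (F) in
/-- The Berkovich open unit disk `{ζ : |ζ| < 1}`. -/
def openUnitDisk : Set (BerkovichProjectiveLine F) :=
  (fun ζ : BerkovichAffineLine F => (ζ : BerkovichProjectiveLine F)) '' {ζ | ζ.abs < 1}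

/-- The unique uniform structure which induces the compact Hausdorff topology of the Berkovich
projective line. -/
instance instUniformSpace : UniformSpace (BerkovichProjectiveLine F) := uniformSpaceOfCompactR1

/-- The Fatou set: the largest open set on which the family of iterates `φ, φ², φ³, …` is
equicontinuous. -/
def fatouSet (φ : F[X]) : Set (BerkovichProjectiveLine F) :=
  ⋃₀ {U | IsOpen U ∧ EquicontinuousOn (fun m : ℕ => (map φ)^[m + 1]) U}

/-- The Julia set: the complement of the Fatou set. -/
def juliaSet (φ : F[X]) : Set (BerkovichProjectiveLine F) := (fatouSet φ)ᶜ

/-- The basin of attraction of `∞`: the points whose iterates converge to `∞`. -/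
def basinOfInfinity (φ : F[X]) : Set (BerkovichProjectiveLine F) :=
  {ζ | Tendsto (fun m : ℕ => (map φ)^[m] ζ) atTop (𝓝 ∞)}

end BerkovichProjectiveLine

/-! ### The field `ℂ_ν` at a finite place of a number field -/

namespace FinitePlaceComplex

variable {K : Type*} [Field K] [NumberField K] (v : HeightOneSpectrum (𝓞 K))

instance instNontriviallyNormedFieldCompletion : NontriviallyNormedField (v.adicCompletion K) :=
  Valued.toNontriviallyNormedField _ (WithZero (Multiplicative ℤ))

/-- An algebraic closure of the completion `K_ν`. -/
abbrev AlgCl : Type _ := AlgebraicClosure (v.adicCompletion K)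

/-- The unique extension to the algebraic closure of the absolute value of `K_ν`. -/
instance instNormedFieldAlgCl : NormedField (AlgCl v) := spectralNorm.normedField (v.adicCompletion K) (AlgCl v)

/-- The field `ℂ_ν`, the completion of the algebraic closure of `K_ν`. -/
abbrev Cv : Type _ := UniformSpace.Completion (AlgCl v)

/-- The embedding of `K` in `ℂ_ν`. -/
def embedding : K →+* Cv v :=
  UniformSpace.Completion.coeRingHom.comp
    ((algebraMap (v.adicCompletion K) (AlgCl v)).comp (algebraMap K (v.adicCompletion K)))

end FinitePlaceComplex

end

/-!
Over an ultrametric field every point of the Berkovich affine line is a nonarchimedean seminorm, so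
`[f]_ζ` is governed by the largest term of `f`.

If `|a₀| > 1`, the constant term of `φ` dominates on the unit disk, so `|φ(ζ)| = |a₀|` there; from
then on the leading term dominates and `|φ^m(ζ)| ≥ |a₀|^m`. The iterates thus converge to `∞`
uniformly on the disk, and a uniformly convergent sequence of continuous maps is equicontinuous.

If `|a₀| ≤ 1`, every iterate has its coefficients in the unit ball of `K`, which is totally bounded
in `ℂ_ν` because the quotients `𝓞_K / 𝔭^N` are finite. On `|ζ| ≤ r < 1` the terms of high degree
are negligible, so finitely many polynomials approximate all the functions `ζ ↦ [f ∘ φ^m]_ζ`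
uniformly, and these functions are equicontinuous.
-/

section UniformSpace

open scoped Uniformity

theorem equicontinuousAt_of_forall_finite_approx {ι X α : Type*} [TopologicalSpace X]
    [UniformSpace α] {G : ι → X → α} {x₀ : X} {s : Set X} (hs : s ∈ 𝓝 x₀)
    (h : ∀ U ∈ 𝓤 α, ∃ P : Set (X → α), P.Finite ∧ (∀ p ∈ P, ContinuousAt p x₀) ∧
      ∀ i, ∃ p ∈ P, ∀ x ∈ s, (G i x, p x) ∈ U) :
    EquicontinuousAt G x₀ := by
  intro U hU
  obtain ⟨V, hV, hVsymm, hVU⟩ := comp_comp_symm_mem_uniformity_sets hU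
  obtain ⟨P, hP, hPcont, hGP⟩ := h V hV
  have hnear : ∀ᶠ x in 𝓝 x₀, ∀ p ∈ P, (p x₀, p x) ∈ V :=
    (eventually_all_finite hP).2 fun p hp => hPcont p hp (UniformSpace.ball_mem_nhds _ hV)
  filter_upwards [hs, hnear] with x hx hxP i
  obtain ⟨p, hp, hGp⟩ := hGP i
  exact hVU ⟨p x, ⟨p x₀, hGp x₀ (mem_of_mem_nhds hs), hxP p hp⟩, hVsymm.symm _ _ (hGp x hx)⟩

theorem equicontinuousAt_of_tendstoUniformlyOn {X α : Type*} [TopologicalSpace X] [UniformSpace α]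
    {G : ℕ → X → α} {g : X → α} {s : Set X} (hG : TendstoUniformlyOn G g atTop s) {x₀ : X}
    (hs : s ∈ 𝓝 x₀) (hg : ContinuousAt g x₀) (hcont : ∀ m, ContinuousAt (G m) x₀) :
    EquicontinuousAt G x₀ := by
  refine equicontinuousAt_of_forall_finite_approx hs fun U hU => ?_
  obtain ⟨M, hM⟩ := eventually_atTop.1 (hG _ (symm_le_uniformity hU))
  refine ⟨insert g (G '' Set.Iio M), ((Set.finite_Iio M).image G).insert g, ?_, fun m => ?_⟩
  · rintro p (rfl | ⟨m, -, rfl⟩)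
    exacts [hg, hcont m]
  · rcases lt_or_ge m M with hm | hm
    · exact ⟨G m, .inr ⟨m, hm, rfl⟩, fun x _ => refl_mem_uniformity hU⟩
    · exact ⟨g, .inl rfl, fun x hx => hM m hm x hx⟩

theorem totallyBounded_univ_pi {ι : Type*} {α : ι → Type*} [∀ i, UniformSpace (α i)]
    {s : ∀ i, Set (α i)} (hs : ∀ i, TotallyBounded (s i)) :
    TotallyBounded (Set.univ.pi s) := by
  simp only [totallyBounded_iff_ultrafilter] at hs ⊢
  intro f hf
  refine (cauchy_pi_iff' α).2 fun i => hs i (f.map (Function.eval i)) ?_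
  rw [Ultrafilter.coe_map, le_principal_iff, mem_map]
  exact mem_of_superset (le_principal_iff.1 hf) fun x hx => hx i (Set.mem_univ i)

end UniformSpace

namespace BerkovichAffineLine

variable {F : Type*} [NormedField F]

theorem abs_nonneg (ζ : BerkovichAffineLine F) : 0 ≤ ζ.abs := apply_nonneg ζ.seminorm X

theorem seminorm_C_mul_X_pow (ζ : BerkovichAffineLine F) (a : F) (i : ℕ) :
    ζ.seminorm (C a * X ^ i) = ‖a‖ * ζ.abs ^ i := by
  rw [map_mul, map_pow, ζ.map_C, abs]

theorem continuous_abs : Continuous (abs : BerkovichAffineLine F → ℝ) := continuous_seminorm X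

theorem setOf_abs_le_mem_nhds {ζ : BerkovichAffineLine F} {r : ℝ} (hr : ζ.abs < r) :
    {ξ : BerkovichAffineLine F | ξ.abs ≤ r} ∈ 𝓝 ζ :=
  continuous_abs.continuousAt.eventually_le_const hr

theorem seminorm_map (φ f : F[X]) (ζ : BerkovichAffineLine F) :
    (map φ ζ).seminorm f = ζ.seminorm (f.comp φ) := rfl

theorem abs_map (φ : F[X]) (ζ : BerkovichAffineLine F) : (map φ ζ).abs = ζ.seminorm φ := by
  rw [abs, seminorm_map, X_comp]

theorem continuous_map (φ : F[X]) : Continuous (map φ) :=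
  isEmbedding_seminorm.continuous_iff.2 <| continuous_pi fun f => continuous_seminorm (f.comp φ)

theorem iterate_map (φ : F[X]) (m : ℕ) : (map φ)^[m] = map (φ.comp^[m] X) := by
  induction m with
  | zero => ext ζ f; simp [seminorm_map]
  | succ m ih =>
    rw [Function.iterate_succ', Function.iterate_succ_apply', ih]
    ext ζ f
    simp [seminorm_map, comp_assoc]

-- The coefficients of `f ∘ g` are fixed linear combinations of coefficients of powers of `g`.
theorem totallyBounded_coeff_comp {R : Type*} [CommRing R] {ι : R →+* F}
    (hι : TotallyBounded (Set.range ι)) (f : F[X]) :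
    TotallyBounded {c | ∃ (g : R[X]) (k : ℕ), (f.comp (g.map ι)).coeff k = c} := by
  have hsum : UniformContinuous fun s : ℕ → F => ∑ i ∈ f.support, f.coeff i * s i :=
    f.support.uniformContinuous_sum fun i _ =>
      (uniformContinuous_mul_left' (f.coeff i)).comp (Pi.uniformContinuous_proj _ i)
  refine ((totallyBounded_univ_pi fun _ => hι).image hsum).subset ?_
  rintro _ ⟨g, k, rfl⟩
  refine ⟨fun i => ι ((g ^ i).coeff k), fun i _ => ⟨_, rfl⟩, ?_⟩
  simp [comp, eval₂_eq_sum, sum_def, finsetSum_coeff, ← Polynomial.map_pow]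

/-- The uniform structure of the Berkovich affine line induced by the evaluations
`ζ ↦ [f]_ζ`. On bounded disks, but not globally, it is the one of the projective line. -/
noncomputable instance instUniformSpace : UniformSpace (BerkovichAffineLine F) :=
  UniformSpace.comap (fun ζ (f : F[X]) => ζ.seminorm f) inferInstance

theorem equicontinuousAt_of_forall_seminorm {κ Y : Type*} [TopologicalSpace Y]
    {G : κ → Y → BerkovichAffineLine F} {y : Y}
    (h : ∀ f : F[X], EquicontinuousAt (fun i z => (G i z).seminorm f) y) :
    EquicontinuousAt G y := by
  have hind : IsUniformInducing fun (ζ : BerkovichAffineLine F) (f : F[X]) => ζ.seminorm f := ⟨rfl⟩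
  rw [hind.equicontinuousAt_iff, Pi.uniformSpace_eq, equicontinuousAt_iInf_rng]
  intro f U hU
  obtain ⟨V, hV, hVU⟩ := mem_comap.1 hU
  filter_upwards [h f V hV] with z hz i using hVU (hz i)

theorem tendsto_coe_comap_abs_atTop :
    Tendsto ((↑) : BerkovichAffineLine F → BerkovichProjectiveLine F) (comap abs atTop) (𝓝 ∞) := by
  refine OnePoint.tendsto_coe_infty.mono_left (hasBasis_coclosedCompact.ge_iff.2 ?_)
  rintro s ⟨-, hs⟩
  obtain ⟨B, hB⟩ := (hs.image continuous_abs).bddAbove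
  refine mem_comap.2 ⟨Set.Ioi B, Ioi_mem_atTop B, fun ζ hζ hmem => ?_⟩
  exact (hB ⟨ζ, hmem, rfl⟩).not_gt hζ

section Ultrametric

variable [IsUltrametricDist F]

-- Taking `k`-th roots as `k → ∞` removes the factor `k + 1`.
theorem seminorm_add_pow_le (ζ : BerkovichAffineLine F) (f g : F[X]) (k : ℕ) :
    ζ.seminorm (f + g) ^ k ≤ (k + 1) * max (ζ.seminorm f) (ζ.seminorm g) ^ k := by
  set M := max (ζ.seminorm f) (ζ.seminorm g)
  have hterm (i : ℕ) (hi : i ∈ Finset.range (k + 1)) :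
      ζ.seminorm (f ^ i * g ^ (k - i) * (k.choose i : F[X])) ≤ M ^ k := by
    have hchoose : ζ.seminorm (k.choose i : F[X]) ≤ 1 := by
      rw [← C_eq_natCast, ζ.map_C]
      exact IsUltrametricDist.norm_natCast_le_one F _
    calc ζ.seminorm (f ^ i * g ^ (k - i) * (k.choose i : F[X]))
        = ζ.seminorm f ^ i * ζ.seminorm g ^ (k - i) * ζ.seminorm (k.choose i : F[X]) := by
          simp only [map_mul, map_pow]
      _ ≤ M ^ i * M ^ (k - i) * 1 := by
          gcongr
          exacts [le_max_left _ _, le_max_right _ _]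
      _ = M ^ k := by
          rw [mul_one, ← pow_add, Nat.add_sub_cancel' (Finset.mem_range_succ_iff.1 hi)]
  calc ζ.seminorm (f + g) ^ k
      = ζ.seminorm (∑ i ∈ Finset.range (k + 1), f ^ i * g ^ (k - i) * (k.choose i : F[X])) := by
        rw [← map_pow, add_pow]
    _ ≤ ∑ i ∈ Finset.range (k + 1), ζ.seminorm (f ^ i * g ^ (k - i) * (k.choose i : F[X])) :=
        Finset.le_sum_of_subadditive _ (map_zero _).le (map_add_le_add _) _ _
    _ ≤ (Finset.range (k + 1)).card • M ^ k := Finset.sum_le_card_nsmul _ _ _ hterm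
    _ = (k + 1) * M ^ k := by simp

theorem isNonarchimedean_seminorm (ζ : BerkovichAffineLine F) :
    IsNonarchimedean ζ.seminorm := by
  intro f g
  by_contra! hlt
  obtain ⟨b, hb, hbs⟩ := exists_between hlt
  have hM : 0 ≤ max (ζ.seminorm f) (ζ.seminorm g) := le_max_of_le_left (apply_nonneg _ _)
  have hb0 : 0 < b := hM.trans_lt hb
  obtain ⟨k, hk⟩ := Real.exists_natCast_add_one_lt_pow_of_one_lt ((one_lt_div hb0).2 hbs)
  rw [div_pow, lt_div_iff₀ (by positivity)] at hk
  refine (ζ.seminorm_add_pow_le f g k).not_gt (lt_of_le_of_lt ?_ hk)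
  gcongr

theorem seminorm_le_of_forall_coeff (ζ : BerkovichAffineLine F) {f : F[X]} {M : ℝ}
    (h : ∀ i, ‖f.coeff i‖ * ζ.abs ^ i ≤ M) : ζ.seminorm f ≤ M := by
  rw [f.as_sum_range_C_mul_X_pow]
  refine (ζ.isNonarchimedean_seminorm.apply_sum_le_sup
    Finset.nonempty_range_add_one).trans (Finset.sup'_le _ _ fun i _ => ?_)
  rw [seminorm_C_mul_X_pow]
  exact h i

theorem seminorm_eq_of_forall_lt (ζ : BerkovichAffineLine F) {f : F[X]} {k : ℕ}
    (hk : k ≤ f.natDegree)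
    (h : ∀ i ≤ f.natDegree, i ≠ k → ‖f.coeff i‖ * ζ.abs ^ i < ‖f.coeff k‖ * ζ.abs ^ k) :
    ζ.seminorm f = ‖f.coeff k‖ * ζ.abs ^ k := by
  simp only [← seminorm_C_mul_X_pow] at h ⊢
  conv_lhs => rw [f.as_sum_range_C_mul_X_pow]
  exact ζ.isNonarchimedean_seminorm.apply_sum_eq_of_lt (fun a => (map_neg_eq_map _ a).symm)
    (Finset.mem_range_succ_iff.2 hk) fun i hi => h i (Finset.mem_range_succ_iff.1 hi)

theorem exists_finite_forall_seminorm_sub_le {T : Set F} (hT : TotallyBounded T) {r : ℝ}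
    (hr0 : 0 ≤ r) (hr1 : r < 1) {δ : ℝ} (hδ : 0 < δ) :
    ∃ P : Set F[X], P.Finite ∧ ∀ g : F[X], (∀ i, g.coeff i ∈ T) →
      ∃ p ∈ P, ∀ ζ : BerkovichAffineLine F, ζ.abs ≤ r → ζ.seminorm (g - p) ≤ δ := by
  obtain ⟨B, hB0, hB⟩ := hT.isBounded.exists_pos_norm_le
  obtain ⟨N, hN⟩ := exists_pow_lt_of_lt_one (div_pos hδ hB0) hr1
  obtain ⟨t, ht, hTt⟩ := Metric.totallyBounded_iff.1 hT δ hδ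
  classical
  refine ⟨ofFn N '' Set.univ.pi fun _ => t, (Set.Finite.pi fun _ => ht).image _, fun g hg => ?_⟩
  have hnet (i : Fin N) : ∃ c ∈ t, ‖g.coeff i - c‖ < δ := by
    simpa [dist_eq_norm] using hTt (hg i)
  choose c hct hc using hnet
  refine ⟨ofFn N c, ⟨c, fun i _ => hct i, rfl⟩, fun ζ hζ =>
    ζ.seminorm_le_of_forall_coeff fun i => ?_⟩
  rcases lt_or_ge i N with hi | hi
  · rw [coeff_sub, ofFn_coeff_eq_val_of_lt c hi]
    exact (mul_le_of_le_one_right (norm_nonneg _)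
      (pow_le_one₀ ζ.abs_nonneg (hζ.trans hr1.le))).trans (hc ⟨i, hi⟩).le
  · rw [coeff_sub, ofFn_coeff_eq_zero_of_ge c hi, sub_zero]
    calc ‖g.coeff i‖ * ζ.abs ^ i ≤ B * r ^ N := by
          gcongr
          · exact pow_nonneg ζ.abs_nonneg i
          · exact hB _ (hg i)
          · exact (pow_le_pow_left₀ ζ.abs_nonneg hζ i).trans (pow_le_pow_of_le_one hr0 hr1.le hi)
      _ ≤ δ := ((lt_div_iff₀' hB0).1 hN).le

theorem equicontinuousAt_seminorm_of_totallyBounded {T : Set F} (hT : TotallyBounded T)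
    {ι : Type*} {g : ι → F[X]} (hg : ∀ i k, (g i).coeff k ∈ T) {ζ₀ : BerkovichAffineLine F}
    (hζ₀ : ζ₀.abs < 1) :
    EquicontinuousAt (fun i (ζ : BerkovichAffineLine F) => ζ.seminorm (g i)) ζ₀ := by
  obtain ⟨r, hr, hr1⟩ := exists_between hζ₀
  refine equicontinuousAt_of_forall_finite_approx (setOf_abs_le_mem_nhds hr) fun U hU => ?_
  obtain ⟨ε, hε, hεU⟩ := Metric.mem_uniformity_dist.1 hU
  obtain ⟨P, hP, hgP⟩ := exists_finite_forall_seminorm_sub_le hT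
    (ζ₀.abs_nonneg.trans hr.le) hr1 (half_pos hε)
  refine ⟨(fun p (ζ : BerkovichAffineLine F) => ζ.seminorm p) '' P, hP.image _, ?_, fun i => ?_⟩
  · rintro _ ⟨p, -, rfl⟩
    exact (continuous_seminorm p).continuousAt
  · obtain ⟨p, hp, hgp⟩ := hgP (g i) (hg i)
    refine ⟨_, ⟨p, hp, rfl⟩, fun ζ hζ => hεU ?_⟩
    calc dist (ζ.seminorm (g i)) (ζ.seminorm p) ≤ ζ.seminorm (g i - p) :=
          abs_sub_map_le_sub ζ.seminorm (g i) p
      _ ≤ ε / 2 := hgp ζ hζ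
      _ < ε := half_lt_self hε

theorem equicontinuousAt_map_of_totallyBounded {R : Type*} [CommRing R] {ι : R →+* F}
    (hι : TotallyBounded (Set.range ι)) {ζ₀ : BerkovichAffineLine F} (hζ₀ : ζ₀.abs < 1) :
    EquicontinuousAt (fun g : R[X] => map (g.map ι)) ζ₀ :=
  equicontinuousAt_of_forall_seminorm fun f => equicontinuousAt_seminorm_of_totallyBounded
    (totallyBounded_coeff_comp hι f) (fun g k => ⟨g, k, rfl⟩) hζ₀

theorem exists_forall_abs_map_le_of_totallyBounded {R : Type*} [CommRing R] {ι : R →+* F}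
    (hι : TotallyBounded (Set.range ι)) :
    ∃ B, ∀ (g : R[X]) {ζ : BerkovichAffineLine F}, ζ.abs ≤ 1 → (map (g.map ι) ζ).abs ≤ B := by
  obtain ⟨B, hB⟩ := hι.isBounded.exists_norm_le
  refine ⟨B, fun g ζ hζ => ?_⟩
  rw [abs_map]
  refine ζ.seminorm_le_of_forall_coeff fun i =>
    (mul_le_of_le_one_right (norm_nonneg _) (pow_le_one₀ ζ.abs_nonneg hζ)).trans ?_
  rw [coeff_map]
  exact hB _ ⟨_, rfl⟩

section Escape

variable {φ : F[X]} {ζ : BerkovichAffineLine F}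

theorem abs_map_eq_norm_coeff_zero (hmonic : φ.Monic) (h0 : 1 < ‖φ.coeff 0‖)
    (hlt : ∀ i, 0 < i → i < φ.natDegree → ‖φ.coeff i‖ < ‖φ.coeff 0‖) (hζ : ζ.abs < 1) :
    (map φ ζ).abs = ‖φ.coeff 0‖ := by
  rw [abs_map, ζ.seminorm_eq_of_forall_lt (Nat.zero_le _), pow_zero, mul_one]
  intro i hi hi0
  rw [pow_zero, mul_one]
  refine (mul_le_of_le_one_right (norm_nonneg _)
    (pow_le_one₀ ζ.abs_nonneg hζ.le)).trans_lt ?_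
  rcases hi.lt_or_eq with hin | rfl
  · exact hlt i (Nat.pos_of_ne_zero hi0) hin
  · rwa [hmonic.coeff_natDegree, norm_one]

theorem abs_map_eq_pow_natDegree (hmonic : φ.Monic) (hdeg : 2 ≤ φ.natDegree) (hζ : 1 < ζ.abs)
    (h0 : ‖φ.coeff 0‖ ≤ ζ.abs) (hlt : ∀ i, 0 < i → i < φ.natDegree → ‖φ.coeff i‖ < ζ.abs) :
    (map φ ζ).abs = ζ.abs ^ φ.natDegree := by
  rw [abs_map, ζ.seminorm_eq_of_forall_lt le_rfl, hmonic.coeff_natDegree, norm_one, one_mul]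
  intro i hi hin
  rw [hmonic.coeff_natDegree, norm_one, one_mul]
  rcases Nat.eq_zero_or_pos i with rfl | hi0
  · rw [pow_zero, mul_one]
    exact h0.trans_lt (lt_self_pow₀ hζ (by lia))
  · calc ‖φ.coeff i‖ * ζ.abs ^ i < ζ.abs * ζ.abs ^ i := by
          have := hlt i hi0 (by lia)
          gcongr
      _ = ζ.abs ^ (i + 1) := (pow_succ' _ _).symm
      _ ≤ ζ.abs ^ φ.natDegree := pow_le_pow_right₀ hζ.le (by lia)

theorem pow_le_abs_iterate_map (hmonic : φ.Monic) (hdeg : 2 ≤ φ.natDegree)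
    (h0 : 1 < ‖φ.coeff 0‖)
    (hlt : ∀ i, 0 < i → i < φ.natDegree → ‖φ.coeff i‖ < ‖φ.coeff 0‖) (hζ : ζ.abs < 1) (m : ℕ) :
    ‖φ.coeff 0‖ ^ (m + 1) ≤ ((map φ)^[m + 1] ζ).abs := by
  induction m with
  | zero => simp [abs_map_eq_norm_coeff_zero hmonic h0 hlt hζ]
  | succ m ih =>
    rw [Function.iterate_succ_apply']
    set ξ := (map φ)^[m + 1] ζ
    have hξ : ‖φ.coeff 0‖ ≤ ξ.abs := (le_self_pow₀ h0.le m.succ_ne_zero).trans ih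
    rw [abs_map_eq_pow_natDegree hmonic hdeg (h0.trans_le hξ) hξ fun i hi hin =>
      (hlt i hi hin).trans_le hξ]
    calc ‖φ.coeff 0‖ ^ (m + 1 + 1) = ‖φ.coeff 0‖ ^ (m + 1) * ‖φ.coeff 0‖ := pow_succ _ _
      _ ≤ ξ.abs * ξ.abs := mul_le_mul ih hξ (norm_nonneg _) ξ.abs_nonneg
      _ = ξ.abs ^ 2 := (sq _).symm
      _ ≤ ξ.abs ^ φ.natDegree := pow_le_pow_right₀ (h0.le.trans hξ) hdeg

end Escape

end Ultrametric

end BerkovichAffineLine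

namespace BerkovichProjectiveLine

variable {F : Type*} [NormedField F]

theorem equicontinuousAt_coe {ι Y : Type*} [TopologicalSpace Y]
    {G : ι → Y → BerkovichAffineLine F} {y : Y} (hG : EquicontinuousAt G y) {R : ℝ}
    (hR : ∀ᶠ z in 𝓝 y, ∀ i, (G i z).abs ≤ R) :
    EquicontinuousAt (fun i z => (G i z : BerkovichProjectiveLine F)) y := by
  have hunif : UniformContinuousOn ((↑) : BerkovichAffineLine F → BerkovichProjectiveLine F)
      {ζ | ζ.abs ≤ R} :=
    (BerkovichAffineLine.isCompact_abs_le R).uniformContinuousOn_of_continuous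
      OnePoint.continuous_coe.continuousOn
  intro U hU
  have hV := hunif hU
  rw [mem_map, mem_inf_principal] at hV
  filter_upwards [hG _ hV, hR] with z hz hzR i
  exact hz i ⟨hR.self_of_nhds i, hzR i⟩

theorem iterate_map_coe (φ : F[X]) (m : ℕ) (ζ : BerkovichAffineLine F) :
    (map φ)^[m] (ζ : BerkovichProjectiveLine F) =
      ((BerkovichAffineLine.map φ)^[m] ζ : BerkovichAffineLine F) := by
  induction m generalizing ζ with
  | zero => rfl
  | succ _ ih => exact ih (BerkovichAffineLine.map φ ζ)

theorem isOpen_openUnitDisk : IsOpen (openUnitDisk F) :=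
  OnePoint.isOpenEmbedding_coe.isOpenMap _
    (isOpen_lt BerkovichAffineLine.continuous_abs continuous_const)

theorem openUnitDisk_subset_fatouSet_of_equicontinuousAt {φ : F[X]}
    (h : ∀ ζ₀ : BerkovichAffineLine F, ζ₀.abs < 1 → EquicontinuousAt
      (fun (m : ℕ) (ζ : BerkovichAffineLine F) =>
        (map φ)^[m + 1] (ζ : BerkovichProjectiveLine F)) ζ₀) :
    openUnitDisk F ⊆ fatouSet φ := by
  refine Set.subset_sUnion_of_mem ⟨isOpen_openUnitDisk, ?_⟩
  rintro _ ⟨ζ₀, hζ₀, rfl⟩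
  refine EquicontinuousAt.equicontinuousWithinAt (fun U hU => ?_) _
  rw [OnePoint.nhds_coe_eq, eventually_map]
  exact h ζ₀ hζ₀ U hU

theorem openUnitDisk_subset_fatouSet_of_totallyBounded [IsUltrametricDist F] {R : Type*}
    [CommRing R] {ι : R →+* F} (hι : TotallyBounded (Set.range ι)) (φ : R[X]) :
    openUnitDisk F ⊆ fatouSet (φ.map ι) := by
  have hcomp (m : ℕ) : (φ.map ι).comp^[m] X = (φ.comp^[m] X).map ι := by
    induction m with
    | zero => simp
    | succ m ih => rw [Function.iterate_succ_apply', Function.iterate_succ_apply', ih, map_comp]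
  obtain ⟨B, hB⟩ := BerkovichAffineLine.exists_forall_abs_map_le_of_totallyBounded hι
  refine openUnitDisk_subset_fatouSet_of_equicontinuousAt fun ζ₀ hζ₀ => ?_
  simp only [iterate_map_coe, BerkovichAffineLine.iterate_map, hcomp]
  refine equicontinuousAt_coe (R := B) ?_ ?_
  · exact (BerkovichAffineLine.equicontinuousAt_map_of_totallyBounded hι hζ₀).comp
      fun m => φ.comp^[m + 1] X
  · filter_upwards [BerkovichAffineLine.setOf_abs_le_mem_nhds hζ₀] with ζ hζ m using hB _ hζ

theorem openUnitDisk_subset_fatouSet_of_norm_coeff_le_one [IsUltrametricDist F] {R : Type*}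
    [CommRing R] {ι : R →+* F} (hι : TotallyBounded (Set.range ι ∩ Metric.closedBall 0 1))
    {φ : R[X]} (hφ : ∀ i, ‖ι (φ.coeff i)‖ ≤ 1) :
    openUnitDisk F ⊆ fatouSet (φ.map ι) := by
  let A : Subring R := (NormedField.valuation (K := F)).integer.comap ι
  have hA : Set.range (ι.comp A.subtype) ⊆ Set.range ι ∩ Metric.closedBall 0 1 := by
    rintro _ ⟨x, rfl⟩
    exact ⟨⟨x, rfl⟩, mem_closedBall_zero_iff.2 x.2⟩
  have hφA : (φ.coeffs : Set R) ⊆ A := fun a ha => by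
    obtain ⟨i, -, rfl⟩ := mem_coeffs_iff.1 ha
    exact hφ i
  rw [← map_toSubring φ A hφA, Polynomial.map_map]
  exact openUnitDisk_subset_fatouSet_of_totallyBounded (hι.subset hA) _

section Escape

variable [IsUltrametricDist F] {φ : F[X]}

theorem tendstoUniformlyOn_iterate_map_infty (hmonic : φ.Monic) (hdeg : 2 ≤ φ.natDegree)
    (h0 : 1 < ‖φ.coeff 0‖)
    (hlt : ∀ i, 0 < i → i < φ.natDegree → ‖φ.coeff i‖ < ‖φ.coeff 0‖) :
    TendstoUniformlyOn (fun (m : ℕ) (ζ : BerkovichAffineLine F) => (map φ)^[m + 1] ↑ζ)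
      (fun _ => ∞) atTop {ζ | ζ.abs < 1} := by
  intro U hU
  obtain ⟨V, hV, hVU⟩ := mem_comap.1 <|
    BerkovichAffineLine.tendsto_coe_comap_abs_atTop (UniformSpace.ball_mem_nhds ∞ hU)
  have hpow : Tendsto (fun m : ℕ => ‖φ.coeff 0‖ ^ (m + 1)) atTop atTop :=
    (tendsto_pow_atTop_atTop_of_one_lt h0).comp (tendsto_add_atTop_nat 1)
  obtain ⟨B, hB⟩ := mem_atTop_sets.1 hV
  filter_upwards [hpow.eventually_ge_atTop B] with m hm ζ hζ
  rw [iterate_map_coe]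
  exact hVU (hB _ (hm.trans
    (BerkovichAffineLine.pow_le_abs_iterate_map hmonic hdeg h0 hlt hζ m)))

theorem openUnitDisk_subset_basinOfInfinity (hmonic : φ.Monic) (hdeg : 2 ≤ φ.natDegree)
    (h0 : 1 < ‖φ.coeff 0‖)
    (hlt : ∀ i, 0 < i → i < φ.natDegree → ‖φ.coeff i‖ < ‖φ.coeff 0‖) :
    openUnitDisk F ⊆ basinOfInfinity φ := by
  rintro _ ⟨ζ, hζ, rfl⟩
  exact (tendsto_add_atTop_iff_nat 1).1
    ((tendstoUniformlyOn_iterate_map_infty hmonic hdeg h0 hlt).tendsto_at hζ)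

theorem openUnitDisk_subset_fatouSet_of_one_lt (hmonic : φ.Monic) (hdeg : 2 ≤ φ.natDegree)
    (h0 : 1 < ‖φ.coeff 0‖)
    (hlt : ∀ i, 0 < i → i < φ.natDegree → ‖φ.coeff i‖ < ‖φ.coeff 0‖) :
    openUnitDisk F ⊆ fatouSet φ := by
  refine openUnitDisk_subset_fatouSet_of_equicontinuousAt fun ζ₀ hζ₀ =>
    equicontinuousAt_of_tendstoUniformlyOn
      (tendstoUniformlyOn_iterate_map_infty hmonic hdeg h0 hlt)
      (BerkovichAffineLine.continuous_abs.continuousAt.eventually_lt_const hζ₀)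
      continuousAt_const fun m => ?_
  simp only [iterate_map_coe]
  exact (OnePoint.continuous_coe.comp
    ((BerkovichAffineLine.continuous_map φ).iterate (m + 1))).continuousAt

end Escape

end BerkovichProjectiveLine

namespace FinitePlaceComplex

variable {K : Type*} [Field K] [NumberField K] (v : HeightOneSpectrum (𝓞 K))

theorem norm_embedding (x : K) :
    ‖embedding v x‖ = WithZeroMulInt.toNNReal
      (NumberField.HeightOneSpectrum.absNorm_ne_zero v) (v.valuation K x) := by
  change ‖((algebraMap (v.adicCompletion K) (AlgCl v)
    (algebraMap K (v.adicCompletion K) x) : AlgCl v) : Cv v)‖ = _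
  rw [UniformSpace.Completion.norm_coe]
  refine (spectralNorm_extends (L := AlgCl v) (algebraMap K (v.adicCompletion K) x)).trans ?_
  rw [← v.valuedAdicCompletion_eq_valuation' x]
  exact NumberField.FinitePlace.norm_def v _

theorem norm_embedding_le_iff {x y : K} :
    ‖embedding v x‖ ≤ ‖embedding v y‖ ↔ v.valuation K x ≤ v.valuation K y := by
  rw [norm_embedding, norm_embedding, NNReal.coe_le_coe, (WithZeroMulInt.toNNReal_strictMono
    (NumberField.HeightOneSpectrum.one_lt_absNorm_nnreal v)).le_iff_le]

theorem norm_embedding_lt_iff {x y : K} :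
    ‖embedding v x‖ < ‖embedding v y‖ ↔ v.valuation K x < v.valuation K y := by
  simp only [← not_le, norm_embedding_le_iff]

theorem norm_embedding_le_one_iff {x : K} : ‖embedding v x‖ ≤ 1 ↔ v.valuation K x ≤ 1 := by
  simpa only [map_one, norm_one] using norm_embedding_le_iff v (x := x) (y := 1)

theorem norm_embedding_lt_one_iff {x : K} : ‖embedding v x‖ < 1 ↔ v.valuation K x < 1 := by
  simpa only [map_one, norm_one] using norm_embedding_lt_iff v (x := x) (y := 1)

theorem one_lt_norm_embedding_iff {x : K} : 1 < ‖embedding v x‖ ↔ 1 < v.valuation K x := by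
  simpa only [map_one, norm_one] using norm_embedding_lt_iff v (x := 1) (y := x)

instance instIsUltrametricDistAlgCl : IsUltrametricDist (AlgCl v) :=
  IsUltrametricDist.isUltrametricDist_of_isNonarchimedean_norm
    (isNonarchimedean_spectralNorm (K := v.adicCompletion K) (L := AlgCl v))

instance instIsUltrametricDistCv : IsUltrametricDist (Cv v) := by
  refine IsUltrametricDist.isUltrametricDist_of_isNonarchimedean_norm fun x y => ?_
  induction x, y using UniformSpace.Completion.induction_on₂ with
  | hp => exact isClosed_le (by fun_prop) (by fun_prop)
  | ih a b =>
    rw [← UniformSpace.Completion.coe_add]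
    simp only [UniformSpace.Completion.norm_coe]
    exact IsUltrametricDist.isNonarchimedean_norm a b

theorem exists_finite_forall_valuation_sub_le (N : ℕ) :
    ∃ S : Set K, S.Finite ∧ ∀ x, v.valuation K x ≤ 1 →
      ∃ s ∈ S, v.valuation K (x - s) ≤ WithZero.exp (-(N : ℤ)) := by
  have : Finite (𝓞 K ⧸ v.asIdeal ^ N) :=
    Ideal.finiteQuotientOfFreeOfNeBot _ (pow_ne_zero N v.ne_bot)
  refine ⟨Set.range fun q : 𝓞 K ⧸ v.asIdeal ^ N => algebraMap (𝓞 K) K q.out, Set.finite_range _,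
    fun x hx => ?_⟩
  obtain ⟨a, ha⟩ := v.exists_valuation_sub_lt_of_integer hx
    (Units.mk0 (WithZero.exp (-(N : ℤ))) WithZero.exp_ne_zero)
  set b : 𝓞 K := (Ideal.Quotient.mk (v.asIdeal ^ N) a).out
  have hab : v.valuation K (algebraMap (𝓞 K) K (a - b)) ≤ WithZero.exp (-(N : ℤ)) := by
    rw [HeightOneSpectrum.valuation_of_algebraMap, HeightOneSpectrum.intValuation_le_pow_iff_mem,
      ← Ideal.Quotient.eq]
    exact (Ideal.Quotient.mk_out _).symm
  refine ⟨algebraMap (𝓞 K) K b, ⟨_, rfl⟩, ?_⟩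
  rw [← sub_add_sub_cancel x (algebraMap (𝓞 K) K a), ← map_sub (algebraMap (𝓞 K) K)]
  exact Valuation.map_add_le _ ((Valuation.map_sub_swap _ _ _).trans_le ha.le) hab

theorem totallyBounded_range_embedding_inter_closedBall :
    TotallyBounded (Set.range (embedding v) ∩ Metric.closedBall 0 1) := by
  refine Metric.totallyBounded_iff.2 fun ε hε => ?_
  obtain ⟨π, hπ⟩ := v.valuation_exists_uniformizer K
  have hπ1 : ‖embedding v π‖ < 1 := by
    rw [norm_embedding_lt_one_iff, hπ, ← WithZero.exp_zero, WithZero.exp_lt_exp]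
    norm_num
  obtain ⟨N, hN⟩ := exists_pow_lt_of_lt_one hε hπ1
  obtain ⟨S, hS, hxS⟩ := exists_finite_forall_valuation_sub_le v N
  refine ⟨embedding v '' S, hS.image _, ?_⟩
  rintro _ ⟨⟨x, rfl⟩, hx⟩
  obtain ⟨s, hs, hxs⟩ := hxS x ((norm_embedding_le_one_iff v).1 (mem_closedBall_zero_iff.1 hx))
  refine Set.mem_iUnion₂.2 ⟨_, ⟨s, hs, rfl⟩, ?_⟩
  have hπN : v.valuation K (π ^ N) = WithZero.exp (-(N : ℤ)) := by
    rw [map_pow, hπ, ← WithZero.exp_nsmul, smul_neg, nsmul_one]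
  rw [mem_ball_iff_norm, ← map_sub]
  calc ‖embedding v (x - s)‖ ≤ ‖embedding v (π ^ N)‖ := by
        rwa [norm_embedding_le_iff, hπN]
    _ < ε := by rwa [map_pow, norm_pow]

end FinitePlaceComplex

theorem lemma3p1_general {R F : Type*} [CommRing R] [NormedField F] [IsUltrametricDist F]
    {ι : R →+* F} (hι : TotallyBounded (Set.range ι ∩ Metric.closedBall 0 1)) {φ : R[X]}
    (hmonic : φ.Monic) (hdeg : 2 ≤ φ.natDegree)
    (hlt : ∀ i, 0 < i → i < φ.natDegree → ‖ι (φ.coeff i)‖ < ‖ι (φ.coeff 0)‖) :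
    Disjoint (BerkovichProjectiveLine.juliaSet (φ.map ι))
        (BerkovichProjectiveLine.openUnitDisk F) ∧
      (1 < ‖ι (φ.coeff 0)‖ → BerkovichProjectiveLine.openUnitDisk F ⊆
        BerkovichProjectiveLine.basinOfInfinity (φ.map ι)) := by
  have hmonic' : (φ.map ι).Monic := hmonic.map ι
  have hdeg' : (φ.map ι).natDegree = φ.natDegree := hmonic.natDegree_map ι
  simp only [← coeff_map, ← hdeg'] at hlt hdeg ⊢
  refine ⟨Set.disjoint_compl_left_iff_subset.2 ?_, fun h0 =>
    BerkovichProjectiveLine.openUnitDisk_subset_basinOfInfinity hmonic' hdeg h0 hlt⟩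
  rcases lt_or_ge 1 ‖(φ.map ι).coeff 0‖ with h0 | h0
  · exact BerkovichProjectiveLine.openUnitDisk_subset_fatouSet_of_one_lt hmonic' hdeg h0 hlt
  refine BerkovichProjectiveLine.openUnitDisk_subset_fatouSet_of_norm_coeff_le_one hι fun i => ?_
  rw [← coeff_map]
  rcases lt_trichotomy i (φ.map ι).natDegree with hi | rfl | hi
  · rcases Nat.eq_zero_or_pos i with rfl | hi0
    exacts [h0, (hlt i hi0 hi).le.trans h0]
  · rw [hmonic'.coeff_natDegree, norm_one]
  · rw [coeff_eq_zero_of_natDegree_lt hi, norm_zero]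
    exact zero_le_one

theorem lemma3p1 {K : Type*} [Field K] [NumberField K] (v : HeightOneSpectrum (𝓞 K))
    (n : ℕ) (hn : 2 ≤ n) (φ : K[X]) (hmonic : φ.Monic) (hdeg : φ.natDegree = n)
    -- Mathlib's valuation is multiplicative, which reverses the order of the additive `ν`
    (h₀ : 1 ≤ v.valuation K (φ.coeff 0))
    (hlt : ∀ i, 0 < i → i < n → v.valuation K (φ.coeff i) < v.valuation K (φ.coeff 0)) :
    Disjoint (BerkovichProjectiveLine.juliaSet (φ.map (FinitePlaceComplex.embedding v)))
        (BerkovichProjectiveLine.openUnitDisk (FinitePlaceComplex.Cv v)) ∧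
      (1 < v.valuation K (φ.coeff 0) →
        BerkovichProjectiveLine.openUnitDisk (FinitePlaceComplex.Cv v) ⊆
          BerkovichProjectiveLine.basinOfInfinity
            (φ.map (FinitePlaceComplex.embedding v))) := by
  subst hdeg
  rw [← FinitePlaceComplex.one_lt_norm_embedding_iff]
  exact lemma3p1_general (FinitePlaceComplex.totallyBounded_range_embedding_inter_closedBall v)
    hmonic hn fun i hi hin => (FinitePlaceComplex.norm_embedding_lt_iff v).2 (hlt i hi hin)
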